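/- All graphs are finite and simple. A clique cut-set of a graph $G$ is a (possibly empty) clique $K$ such that $G\setminus K$ is disconnected, where the graph without vertices is not regarded as disconnected; an atom is a graph with no clique cut-set. A graph is $(H_1,H_2)$-free if neither $H_1$ nor $H_2$ is isomorphic to an induced subgraph of it. The clique-width of a graph $G$ is the minimum number of labels needed to construct $G$ by the operations: (1) create a single vertex with label $i$; (2) take the disjoint union of two labelled graphs; (3) add all edges between vertices labelled $i$ and vertices labelled $j$, where $i\neq j$; (4) relabel every vertex with label $i$ to have label $j$. A class of graphs has unbounded clique-width if no constant bounds the clique-width of all its members. Let $P_t$ denote the path on $t$ vertices, $+$ the disjoint union, $2P_2=P_2+P_2$, $\overline{H}$ the complement of $H$, and let the gem be $\overline{P_1+P_4}$. Then the class of $(\mathrm{gem},P_1+2P_2)$-free atoms has unbounded clique-width, and the class of $(P_1+P_4,\overline{P_1+2P_2})$-free atoms has unbounded clique-width. -/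

import Mathlib

open scoped SimpleGraph

namespace CliqueWidth

/-- Expressions with `k` labels over the four operations that define clique-width. -/
inductive Expr (k : ℕ) : Type
  /-- create a single vertex with label `i` -/
  | vertex (i : Fin k) : Expr k
  /-- disjoint union of two labelled graphs -/
  | union (s t : Expr k) : Expr k
  /-- add all edges between vertices labelled `i` and vertices labelled `j`, where `i ≠ j` -/
  | join (i j : Fin k) (hij : i ≠ j) (t : Expr k) : Expr k
  /-- give label `j` to every vertex labelled `i` -/
  | relabel (i j : Fin k) (t : Expr k) : Expr k

namespace Expr

/-- The vertex set of the labelled graph built by an expression. -/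
def Vertex {k : ℕ} : Expr k → Type
  | vertex _ => Unit
  | union s t => s.Vertex ⊕ t.Vertex
  | join _ _ _ t => t.Vertex
  | relabel _ _ t => t.Vertex

/-- The labels of the vertices of the labelled graph built by an expression. -/
def label {k : ℕ} : (t : Expr k) → t.Vertex → Fin k
  | vertex i => fun _ => i
  | union s t => Sum.elim s.label t.label
  | join _ _ _ t => t.label
  | relabel i j t => fun v => if t.label v = i then j else t.label v

/-- The edges of the labelled graph built by an expression. -/
def graph {k : ℕ} : (t : Expr k) → SimpleGraph t.Vertex
  | vertex _ => (⊥ : SimpleGraph Unit)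
  | union s t => s.graph ⊕g t.graph
  | join i j _ t => t.graph ⊔ SimpleGraph.fromRel (fun u v => t.label u = i ∧ t.label v = j)
  | relabel _ _ t => t.graph

end Expr

/-- The clique-width of a graph: the minimum number of labels needed to construct it. Every finite
graph with at least one vertex is built by some expression; the graph without vertices is built by
none, and the value for it is `0`. Only finite graphs are considered. -/
noncomputable def cliqueWidth {V : Type} (G : SimpleGraph V) : ℕ :=
  sInf {k : ℕ | ∃ t : Expr k, Nonempty (t.graph ≃g G)}

/-- A class of graphs; only its finite members matter below. -/
abbrev GraphClass : Type 1 := ∀ V : Type, SimpleGraph V → Prop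

/-- A class of finite graphs has bounded clique-width if some constant bounds the clique-width of
all its members. -/
def BoundedCliqueWidth (C : GraphClass) : Prop :=
  ∃ c : ℕ, ∀ (V : Type) [Finite V] (G : SimpleGraph V), C V G → cliqueWidth G ≤ c

/-- `K` is a clique whose removal leaves a disconnected graph. (A graph without vertices does not
count as disconnected, so the whole vertex set of a complete graph is not a cut-set.) -/
def IsCliqueCutset {V : Type} (G : SimpleGraph V) (K : Set V) : Prop :=
  G.IsClique K ∧ ¬ (G.induce Kᶜ).Preconnected

/-- A graph is an atom if it has no clique cut-set. With the empty clique this includes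
connectedness. -/
def IsGraphAtom {V : Type} (G : SimpleGraph V) : Prop :=
  ∀ K : Set V, ¬ IsCliqueCutset G K

/-- `G` is `H`-free: `H` is not (isomorphic to) an induced subgraph of `G`. -/
def InducedFree {W V : Type} (H : SimpleGraph W) (G : SimpleGraph V) : Prop :=
  ¬ H.IsIndContained G

/-- The class of `(H₁, H₂)`-free atoms. -/
def freeAtoms {W₁ W₂ : Type} (H₁ : SimpleGraph W₁) (H₂ : SimpleGraph W₂) : GraphClass :=
  fun _ G => IsGraphAtom G ∧ InducedFree H₁ G ∧ InducedFree H₂ G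

/-- The graph `P₁ + P₄`. -/
abbrev P1P4 : SimpleGraph (Fin 1 ⊕ Fin 4) :=
  SimpleGraph.pathGraph 1 ⊕g SimpleGraph.pathGraph 4

/-- The gem, that is, the complement of `P₁ + P₄`. -/
abbrev gem : SimpleGraph (Fin 1 ⊕ Fin 4) := P1P4ᶜ

/-- The graph `P₁ + 2P₂`. -/
abbrev P1twoP2 : SimpleGraph (Fin 1 ⊕ (Fin 2 ⊕ Fin 2)) :=
  SimpleGraph.pathGraph 1 ⊕g (SimpleGraph.pathGraph 2 ⊕g SimpleGraph.pathGraph 2)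

end CliqueWidth

namespace CliqueWidth

namespace Expr

/-! One family serves both claims: `gridGraph n` for the first and its complement for the second.
Complementation exchanges the two pairs of forbidden graphs, and `OuterLabelling.of_compl` lets one
width bound cover both.

For that bound, cutting an expression at a suitable subexpression gives a vertex set `U` that takes
a medium share of the first side, while its vertices have at most `k` distinct neighbourhoods
outside `U` (`exists_balanced_outerLabelling`). In the grid this is impossible for small `k`
(`gridGraph_unbalanced`): few rows and columns are split by `U`, so some row lies wholly inside and
another wholly outside. Each column then is split by `U` or contributes a matching edge leaving `U`,
and only `3 * k` columns can do so. -/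

instance finite_vertex {k : ℕ} (t : Expr k) : Finite t.Vertex := by
  induction t with
  | vertex i => exact inferInstanceAs (Finite Unit)
  | union s t hs ht => exact inferInstanceAs (Finite (s.Vertex ⊕ t.Vertex))
  | join i j hij t ht => exact ht
  | relabel i j t ht => exact ht

lemma join_adj {k : ℕ} (i j : Fin k) (hij : i ≠ j) (t : Expr k) (u v : t.Vertex) :
    (join i j hij t).graph.Adj u v ↔ t.graph.Adj u v ∨
      (u ≠ v ∧ ((t.label u = i ∧ t.label v = j) ∨ (t.label v = i ∧ t.label u = j))) := Iff.rfl

end Expr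

/-! ### Balanced vertex sets from subexpressions -/

/-- `ℓ` distinguishes all neighbourhoods that vertices of `U` have outside `U`. -/
def OuterLabelling {V : Type} {k : ℕ} (G : SimpleGraph V) (U : Set V) (ℓ : V → Fin k) : Prop :=
  ∀ u ∈ U, ∀ v ∈ U, ℓ u = ℓ v → ∀ w ∉ U, (G.Adj u w ↔ G.Adj v w)

lemma OuterLabelling.of_compl {V : Type} {k : ℕ} {G : SimpleGraph V} {U : Set V} {ℓ : V → Fin k}
    (h : OuterLabelling Gᶜ U ℓ) : OuterLabelling G U ℓ := by
  intro u hu v hv huv w hw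
  have h1 := h u hu v hv huv w hw
  have h2 : u ≠ w := fun e => hw (e ▸ hu)
  have h3 : v ≠ w := fun e => hw (e ▸ hv)
  simp only [SimpleGraph.compl_adj, h2, h3, ne_eq, not_false_eq_true, true_and] at h1
  exact not_iff_not.mp h1

/-- Some subexpression contains between `m` and `2 * m` vertices of `P`. -/
lemma Expr.exists_balanced_outerLabelling {k m : ℕ} (hm : 2 ≤ m) (t : Expr k) (P : Set t.Vertex)
    (hP : m ≤ P.ncard) :
    ∃ (U : Set t.Vertex) (ℓ : t.Vertex → Fin k), m ≤ (U ∩ P).ncard ∧ (U ∩ P).ncard ≤ 2 * m ∧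
      OuterLabelling t.graph U ℓ ∧ ∀ u ∈ U, ∀ v ∈ U, ℓ u = ℓ v → t.label u = t.label v := by
  by_cases hle : P.ncard ≤ 2 * m
  · exact ⟨Set.univ, t.label, by simpa using hP, by simpa using hle,
      fun _ _ _ _ _ _ hw => absurd (Set.mem_univ _) hw, fun _ _ _ _ h => h⟩
  -- Descend while more than `2 * m` vertices of `P` remain. At a union one operand keeps at least
  -- `m` of them; if it has at most `2 * m`, it is taken whole.
  induction t with
  | vertex i =>
    exfalso
    have : P.ncard ≤ (Set.univ : Set Unit).ncard := Set.ncard_le_ncard (Set.subset_univ P)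
    rw [Set.ncard_univ, Nat.card_unique] at this
    omega
  | union s t hs ht =>
    change Set (s.Vertex ⊕ t.Vertex) at P
    have hcard : P.ncard ≤ (Sum.inl ⁻¹' P : Set s.Vertex).ncard
        + (Sum.inr ⁻¹' P : Set t.Vertex).ncard := by
      have e : P = Sum.inl '' (Sum.inl ⁻¹' P) ∪ Sum.inr '' (Sum.inr ⁻¹' P) := by
        ext (x | x) <;> simp
      conv_lhs => rw [e]
      refine (Set.ncard_union_le _ _).trans ?_
      rw [Set.ncard_image_of_injective _ Sum.inl_injective,
        Set.ncard_image_of_injective _ Sum.inr_injective]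
    by_cases h : m ≤ (Sum.inl ⁻¹' P : Set s.Vertex).ncard
    · have key : ∃ (U : Set s.Vertex) (ℓ : s.Vertex → Fin k), m ≤ (U ∩ Sum.inl ⁻¹' P).ncard ∧
          (U ∩ Sum.inl ⁻¹' P).ncard ≤ 2 * m ∧
          OuterLabelling s.graph U ℓ ∧ ∀ u ∈ U, ∀ v ∈ U, ℓ u = ℓ v → s.label u = s.label v := by
        by_cases h2 : (Sum.inl ⁻¹' P : Set s.Vertex).ncard ≤ 2 * m
        · exact ⟨Set.univ, s.label, by simpa using h, by simpa using h2,
            fun _ _ _ _ _ _ hw => absurd (Set.mem_univ _) hw, fun _ _ _ _ h => h⟩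
        · exact hs _ h h2
      obtain ⟨U, ℓ, h1, h2, h3, h4⟩ := key
      have e : (Sum.inl '' U ∩ P).ncard = (U ∩ Sum.inl ⁻¹' P).ncard := by
        rw [← Set.image_inter_preimage, Set.ncard_image_of_injective _ Sum.inl_injective]
      refine ⟨Sum.inl '' U, Sum.elim ℓ t.label, e ▸ h1, e ▸ h2, ?_, ?_⟩
      · rintro _ ⟨u, hu, rfl⟩ _ ⟨v, hv, rfl⟩ huv (w | w) hw
        · exact h3 u hu v hv huv w (fun hw' => hw ⟨w, hw', rfl⟩)
        · simp [Expr.graph]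
      · rintro _ ⟨u, hu, rfl⟩ _ ⟨v, hv, rfl⟩ huv
        exact h4 u hu v hv huv
    · have h' : m ≤ (Sum.inr ⁻¹' P : Set t.Vertex).ncard := by
        by_contra h'
        exact hle (le_trans hcard (by omega))
      have key : ∃ (U : Set t.Vertex) (ℓ : t.Vertex → Fin k), m ≤ (U ∩ Sum.inr ⁻¹' P).ncard ∧
          (U ∩ Sum.inr ⁻¹' P).ncard ≤ 2 * m ∧
          OuterLabelling t.graph U ℓ ∧ ∀ u ∈ U, ∀ v ∈ U, ℓ u = ℓ v → t.label u = t.label v := by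
        by_cases h2 : (Sum.inr ⁻¹' P : Set t.Vertex).ncard ≤ 2 * m
        · exact ⟨Set.univ, t.label, by simpa using h', by simpa using h2,
            fun _ _ _ _ _ _ hw => absurd (Set.mem_univ _) hw, fun _ _ _ _ h => h⟩
        · exact ht _ h' h2
      obtain ⟨U, ℓ, h1, h2, h3, h4⟩ := key
      have e : (Sum.inr '' U ∩ P).ncard = (U ∩ Sum.inr ⁻¹' P).ncard := by
        rw [← Set.image_inter_preimage, Set.ncard_image_of_injective _ Sum.inr_injective]
      refine ⟨Sum.inr '' U, Sum.elim s.label ℓ, e ▸ h1, e ▸ h2, ?_, ?_⟩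
      · rintro _ ⟨u, hu, rfl⟩ _ ⟨v, hv, rfl⟩ huv (w | w) hw
        · simp [Expr.graph]
        · exact h3 u hu v hv huv w (fun hw' => hw ⟨w, hw', rfl⟩)
      · rintro _ ⟨u, hu, rfl⟩ _ ⟨v, hv, rfl⟩ huv
        exact h4 u hu v hv huv
  -- Later joins see only current labels. The last conjunct says that equal `ℓ` forces equal current
  -- labels, so a join treats such vertices alike.
  | join i j hij t ht =>
    obtain ⟨U, ℓ, h1, h2, h3, h4⟩ := ht P hP hle
    refine ⟨U, ℓ, h1, h2, fun u hu v hv huv w hw => ?_, h4⟩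
    have h5 := h3 u hu v hv huv w hw
    have h6 : u ≠ w := fun e => hw (e ▸ hu)
    have h7 : v ≠ w := fun e => hw (e ▸ hv)
    have h8 := h4 u hu v hv huv
    refine (Expr.join_adj i j hij t u w).trans (Iff.trans ?_ (Expr.join_adj i j hij t v w).symm)
    rw [h5, h8]
    exact or_congr_right (and_congr_left' (iff_of_true h6 h7))
  | relabel i j t ht =>
    obtain ⟨U, ℓ, h1, h2, h3, h4⟩ := ht P hP hle
    refine ⟨U, ℓ, h1, h2, h3, fun u hu v hv huv => ?_⟩
    have h8 := h4 u hu v hv huv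
    change (if t.label u = i then j else t.label u) = (if t.label v = i then j else t.label v)
    rw [h8]

/-! ### Every finite nonempty graph has an expression -/

lemma Expr.exists_vertices {V : Type} {k : ℕ} (e : V → Fin k) (s : Finset V) (hs : s.Nonempty) :
    ∃ (t : Expr k) (f : t.Vertex → V), Function.Injective f ∧ Set.range f = s ∧
      t.label = e ∘ f ∧ t.graph = ⊥ := by
  induction hs using Finset.Nonempty.cons_induction with
  | singleton a =>
    exact ⟨.vertex (e a), fun _ => a, fun (_ : Unit) (_ : Unit) _ => rfl,
      by ext x; constructor
         · rintro ⟨_, rfl⟩; simp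
         · intro hx; exact ⟨(() : Unit), (by simpa using hx : x = a).symm⟩, rfl, rfl⟩
  | cons a s ha hs ih =>
    obtain ⟨t, f, hf, hr, hl, hg⟩ := ih
    have hfa : ∀ x, f x ≠ a := fun x hx => ha (by
      have : f x ∈ Set.range f := ⟨x, rfl⟩
      rw [hr, hx] at this; exact this)
    refine ⟨.union (.vertex (e a)) t, Sum.elim (fun _ => a) f, ?_, ?_, ?_, ?_⟩
    · rintro (x | x) (y | y) hxy
      · rfl
      · exact absurd hxy.symm (hfa y)
      · exact absurd hxy (hfa x)
      · exact congrArg Sum.inr (hf hxy)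
    · ext x
      constructor
      · rintro ⟨y | y, rfl⟩
        · simp
        · have : f y ∈ Set.range f := ⟨y, rfl⟩
          rw [hr] at this
          simpa using Or.inr this
      · intro hx
        rcases (by simpa using hx : x = a ∨ x ∈ s) with rfl | hx
        · exact ⟨Sum.inl (() : Unit), rfl⟩
        · have : x ∈ Set.range f := by rw [hr]; exact hx
          obtain ⟨y, rfl⟩ := this
          exact ⟨Sum.inr y, rfl⟩
    · funext x
      rcases x with x | x
      · rfl
      · exact congrFun hl x
    · change (⊥ : SimpleGraph Unit) ⊕g t.graph = ⊥
      rw [hg]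
      ext x y
      rcases x with x | x <;> rcases y with y | y <;> simp

/-- With a private label for each vertex, a join adds exactly one edge. This makes the infimum in
`cliqueWidth` attained rather than the default value `0` of an empty infimum. -/
lemma Expr.exists_edges {V : Type} {k : ℕ} (e : V ≃ Fin k) [Nonempty V]
    (s : Finset (V × V)) (hs : ∀ p ∈ s, p.1 ≠ p.2) :
    ∃ (t : Expr k) (f : t.Vertex ≃ V), t.label = e ∘ f ∧
      ∀ x y, t.graph.Adj x y ↔ (f x, f y) ∈ s ∨ (f y, f x) ∈ s := by
  classical
  have : Fintype V := Fintype.ofEquiv _ e.symm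
  induction s using Finset.induction_on with
  | empty =>
    obtain ⟨t, f, hf, hr, hl, hg⟩ := Expr.exists_vertices e Finset.univ Finset.univ_nonempty
    exact ⟨t, Equiv.ofBijective f ⟨hf, Set.range_eq_univ.mp (by simpa using hr)⟩, hl,
      by simp [hg]⟩
  | insert p s hp ih =>
    obtain ⟨t, f, hl, hg⟩ := ih fun q hq => hs q (Finset.mem_insert_of_mem hq)
    have hne : p.1 ≠ p.2 := hs p (Finset.mem_insert_self _ _)
    refine ⟨.join (e p.1) (e p.2) (e.injective.ne hne) t, f, hl, fun x y => (Expr.join_adj _ _ _ t x y).trans ?_⟩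
    have hlab : ∀ (x : t.Vertex) v, t.label x = e v ↔ f x = v := fun x v => by simp [hl]
    change t.Vertex at x y
    have hxy : (f x = p.1 ∧ f y = p.2 ∨ f y = p.1 ∧ f x = p.2) → x ≠ y := by
      rintro (⟨h1, h2⟩ | ⟨h1, h2⟩) rfl <;> exact hne (h1.symm.trans h2)
    obtain ⟨a, b⟩ := p
    rw [hlab, hlab, hlab, hlab, hg, Finset.mem_insert, Finset.mem_insert, Prod.mk_inj, Prod.mk_inj]
    tauto

lemma exists_expr {V : Type} [Finite V] [Nonempty V] (G : SimpleGraph V) :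
    ∃ (k : ℕ) (t : Expr k), Nonempty (t.graph ≃g G) := by
  classical
  have := Fintype.ofFinite V
  obtain ⟨t, f, -, hg⟩ := Expr.exists_edges (Fintype.equivFin V)
    (Finset.univ.filter fun p : V × V => G.Adj p.1 p.2) (by
      intro p hp; exact (Finset.mem_filter.mp hp).2.ne)
  refine ⟨_, t, ⟨⟨f, fun {x y} => ?_⟩⟩⟩
  rw [hg]
  simp [G.adj_comm (f y)]

lemma exists_expr_cliqueWidth {V : Type} [Finite V] [Nonempty V] (G : SimpleGraph V) :
    ∃ t : Expr (cliqueWidth G), Nonempty (t.graph ≃g G) :=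
  Nat.sInf_mem (s := {k : ℕ | ∃ t : Expr k, Nonempty (t.graph ≃g G)}) (exists_expr G)

lemma exists_balanced_outerLabelling {V : Type} [Finite V] [Nonempty V] (G : SimpleGraph V)
    {m : ℕ} (hm : 2 ≤ m) (P : Set V) (hP : m ≤ P.ncard) :
    ∃ (U : Set V) (ℓ : V → Fin (cliqueWidth G)), m ≤ (U ∩ P).ncard ∧ (U ∩ P).ncard ≤ 2 * m ∧
      OuterLabelling G U ℓ := by
  obtain ⟨t, ⟨φ⟩⟩ := exists_expr_cliqueWidth G
  have hcard : ∀ S : Set V, (φ ⁻¹' S).ncard = S.ncard := fun S =>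
    Set.ncard_preimage_of_injective_subset_range φ.injective (by simp [φ.surjective.range_eq])
  obtain ⟨U, ℓ, h1, h2, h3, -⟩ :=
    t.exists_balanced_outerLabelling hm (φ ⁻¹' P) (by rwa [hcard])
  have e : U ∩ φ ⁻¹' P = φ ⁻¹' (φ.symm ⁻¹' U ∩ P) := by ext x; simp
  rw [e, hcard] at h1 h2
  refine ⟨φ.symm ⁻¹' U, ℓ ∘ φ.symm, h1, h2, fun u hu v hv huv w hw => ?_⟩
  have := h3 _ hu _ hv huv _ hw
  simpa [SimpleGraph.Iso.map_adj_iff] using this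

/-! ### The grid graph and its forbidden induced subgraphs -/

/-- The part of the side `b` that contains the cell `p`: its row on one side, its column on the
other. -/
def gridPart {n : ℕ} (b : Bool) (p : Fin n × Fin n) : Fin n := if b then p.2 else p.1

/-- Two copies of the cells of an `n × n` grid, the first complete multipartite with the rows as
parts, the second complete multipartite with the columns as parts, joined by a perfect matching. -/
def gridGraph (n : ℕ) : SimpleGraph (Bool × (Fin n × Fin n)) where
  Adj u v := (u.1 = v.1 ∧ gridPart u.1 u.2 ≠ gridPart v.1 v.2) ∨ (u.1 ≠ v.1 ∧ u.2 = v.2)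
  symm := ⟨fun u v h => by
    rcases h with ⟨h1, h2⟩ | ⟨h1, h2⟩
    · exact Or.inl ⟨h1.symm, h2.symm⟩
    · exact Or.inr ⟨h1.symm, h2.symm⟩⟩
  loopless := ⟨fun u h => by simp at h⟩

lemma gridGraph_adj {n : ℕ} {b c : Bool} {p q : Fin n × Fin n} :
    (gridGraph n).Adj (b, p) (c, q) ↔
      (b = c ∧ gridPart b p ≠ gridPart c q) ∨ (b ≠ c ∧ p = q) := Iff.rfl

lemma gridPart_ext {n : ℕ} (b : Bool) {p q : Fin n × Fin n} (h1 : gridPart b p = gridPart b q)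
    (h2 : gridPart (!b) p = gridPart (!b) q) : p = q := by
  cases b <;> simp_all [gridPart, Prod.ext_iff]

lemma exists_gridPart {n : ℕ} (b : Bool) (i j : Fin n) :
    ∃ p : Fin n × Fin n, gridPart b p = i ∧ gridPart (!b) p = j := by
  cases b
  · exact ⟨(i, j), rfl, rfl⟩
  · exact ⟨(j, i), rfl, rfl⟩

/-- A neighbourhood is a complete multipartite graph plus an isolated vertex, the matching partner,
and so contains no induced `P₄`. -/
lemma gridGraph_gem_free (n : ℕ) : InducedFree gem (gridGraph n) := by
  rintro ⟨f⟩
  have hc : ∀ i : Fin 4, (gridGraph n).Adj (f (.inl 0)) (f (.inr i)) := fun i => by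
    rw [f.map_rel_iff]; simp [P1P4, gem]
  have hp : ∀ i j : Fin 4, (gridGraph n).Adj (f (.inr i)) (f (.inr j)) ↔
      i ≠ j ∧ ¬ (i.val + 1 = j.val ∨ j.val + 1 = i.val) := fun i j => by
    rw [f.map_rel_iff]; simp [P1P4, gem, SimpleGraph.pathGraph_adj]
  have h02 := (hp 0 2).mpr (by decide)
  have h03 := (hp 0 3).mpr (by decide)
  have h13 := (hp 1 3).mpr (by decide)
  have h01 := mt (hp 0 1).mp (by decide)
  have h12 := mt (hp 1 2).mp (by decide)
  have h23 := mt (hp 2 3).mp (by decide)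
  have c0 := hc 0
  have c1 := hc 1
  have c2 := hc 2
  have c3 := hc 3
  generalize f (.inl 0) = c at *
  generalize f (.inr 0) = v0 at *
  generalize f (.inr 1) = v1 at *
  generalize f (.inr 2) = v2 at *
  generalize f (.inr 3) = v3 at *
  clear hp hc f
  obtain ⟨b, p⟩ := c
  obtain ⟨b0, p0⟩ := v0
  obtain ⟨b1, p1⟩ := v1
  obtain ⟨b2, p2⟩ := v2
  obtain ⟨b3, p3⟩ := v3
  simp only [gridGraph_adj] at *
  cases b <;> cases b0 <;> cases b1 <;> cases b2 <;> cases b3 <;> grind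

/-- The non-neighbours of `c` are the rest of its own part and the opposite side without its
partner. An induced `2P₂` there must consist of two matching edges, whose cells share both row and
column and hence coincide. -/
lemma gridGraph_P1twoP2_free (n : ℕ) : InducedFree P1twoP2 (gridGraph n) := by
  rintro ⟨f⟩
  have hc : ∀ i, ¬ (gridGraph n).Adj (f (.inl 0)) (f (.inr i)) := fun i => by
    rw [f.map_rel_iff]; simp
  have hp : ∀ i j, (gridGraph n).Adj (f (.inr i)) (f (.inr j)) ↔
      (SimpleGraph.pathGraph 2 ⊕g SimpleGraph.pathGraph 2).Adj i j := fun i j => by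
    rw [f.map_rel_iff]; simp
  have h1 := (hp (.inl 0) (.inl 1)).mpr (by simp [SimpleGraph.pathGraph_adj])
  have h2 := (hp (.inr 0) (.inr 1)).mpr (by simp [SimpleGraph.pathGraph_adj])
  have h3 := mt (hp (.inl 0) (.inr 0)).mp (by simp)
  have h4 := mt (hp (.inl 0) (.inr 1)).mp (by simp)
  have h5 := mt (hp (.inl 1) (.inr 0)).mp (by simp)
  have h6 := mt (hp (.inl 1) (.inr 1)).mp (by simp)
  have n1 : f (.inl 0) ≠ f (.inr (.inl 0)) := f.injective.ne (by simp)
  have n2 : f (.inl 0) ≠ f (.inr (.inl 1)) := f.injective.ne (by simp)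
  have n3 : f (.inl 0) ≠ f (.inr (.inr 0)) := f.injective.ne (by simp)
  have n4 : f (.inl 0) ≠ f (.inr (.inr 1)) := f.injective.ne (by simp)
  have c1 := hc (.inl 0)
  have c2 := hc (.inl 1)
  have c3 := hc (.inr 0)
  have c4 := hc (.inr 1)
  generalize f (.inl 0) = c at *
  generalize f (.inr (.inl 0)) = v0 at *
  generalize f (.inr (.inl 1)) = v1 at *
  generalize f (.inr (.inr 0)) = v2 at *
  generalize f (.inr (.inr 1)) = v3 at *
  clear hp hc f
  obtain ⟨b, p⟩ := c
  obtain ⟨b0, p0⟩ := v0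
  obtain ⟨b1, p1⟩ := v1
  obtain ⟨b2, p2⟩ := v2
  obtain ⟨b3, p3⟩ := v3
  have hext : ∀ (b : Bool) (p q : Fin n × Fin n), gridPart b p = gridPart b q →
    gridPart (!b) p = gridPart (!b) q → p = q := fun b _ _ => gridPart_ext b
  have hf := hext false
  simp only [Bool.not_false] at hf
  clear hext
  simp only [gridGraph_adj, ne_eq, Prod.mk.injEq] at *
  cases b <;> cases b0 <;> cases b1 <;> cases b2 <;> cases b3 <;> grind

/-! ### Absence of clique cut-sets -/

/-- A clique has at most one vertex in each part, so what is left of each side stays connected, and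
it cannot break all matching edges. -/
lemma gridGraph_isGraphAtom {n : ℕ} (hn : 2 ≤ n) : IsGraphAtom (gridGraph n) := by
  rintro K ⟨hK, hdis⟩
  apply hdis
  have hK' : ∀ b p q, (b, p) ∈ K → (b, q) ∈ K → gridPart b p = gridPart b q → p = q := by
    intro b p q h1 h2 h3
    by_contra hne
    have := hK h1 h2 (by simpa using hne)
    simp [gridGraph_adj, h3] at this
  have hK2 : ∀ p q, (false, p) ∈ K → (true, q) ∈ K → p = q := by
    intro p q h1 h2
    have := hK h1 h2 (by simp)
    simpa [gridGraph_adj] using this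
  have hfree : ∀ (b : Bool) (p : Fin n × Fin n), ∃ q, gridPart b q ≠ gridPart b p ∧
      (b, q) ∉ K := by
    intro b p
    have : Nontrivial (Fin n) := Fin.nontrivial_iff_two_le.mpr hn
    obtain ⟨i, hi⟩ := exists_ne (gridPart b p)
    obtain ⟨j, hj⟩ := exists_ne i
    obtain ⟨q, hq1, hq2⟩ := exists_gridPart b i i
    obtain ⟨r, hr1, hr2⟩ := exists_gridPart b i j
    by_cases h1 : (b, q) ∈ K
    · refine ⟨r, hr1 ▸ hi, fun h2 => hj ?_⟩
      rw [← hr2, ← hq2, hK' b q r h1 h2 (hq1.trans hr1.symm)]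
    · exact ⟨q, hq1 ▸ hi, h1⟩
  have hside : ∀ (b : Bool) (p q : Fin n × Fin n) (hp : (b, p) ∈ Kᶜ) (hq : (b, q) ∈ Kᶜ),
      ((gridGraph n).induce Kᶜ).Reachable ⟨_, hp⟩ ⟨_, hq⟩ := by
    intro b p q hp hq
    have hadj : ∀ (p q : Fin n × Fin n) (hp : (b, p) ∈ Kᶜ) (hq : (b, q) ∈ Kᶜ),
        gridPart b p ≠ gridPart b q →
        ((gridGraph n).induce Kᶜ).Reachable ⟨_, hp⟩ ⟨_, hq⟩ := fun p q hp hq h =>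
      SimpleGraph.Adj.reachable (by
        rw [SimpleGraph.comap_adj]; exact Or.inl ⟨rfl, h⟩)
    by_cases h : gridPart b p = gridPart b q
    · obtain ⟨r, hr, hrK⟩ := hfree b p
      exact (hadj p r hp hrK hr.symm).trans (hadj r q hrK hq (h ▸ hr))
    · exact hadj p q hp hq h
  obtain ⟨r, hr0, hr1⟩ : ∃ r, (false, r) ∉ K ∧ (true, r) ∉ K := by
    -- The four cells of a `2 × 2` subgrid suffice: a clique meeting both sides covers just one
    -- cell, and one inside a single side covers at most two of the four.
    by_contra! hcon
    let i : Fin n := ⟨0, by omega⟩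
    let j : Fin n := ⟨1, by omega⟩
    have hij : i ≠ j := by simp [i, j]
    have k1 := hcon (i, i)
    have k2 := hcon (i, j)
    have k3 := hcon (j, i)
    have k4 := hcon (j, j)
    have a1 := hK' false (i, i) (i, j)
    have a2 := hK' false (j, i) (j, j)
    have a3 := hK' true (i, i) (j, i)
    have a4 := hK' true (i, j) (j, j)
    have b1 := hK2 (i, i)
    have b2 := hK2 (i, j)
    have b3 := hK2 (j, i)
    have b4 := hK2 (j, j)
    simp only [gridPart] at a1 a2 a3 a4
    grind
  have hmid : ((gridGraph n).induce Kᶜ).Reachable ⟨_, hr0⟩ ⟨_, hr1⟩ :=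
    SimpleGraph.Adj.reachable (by
      rw [SimpleGraph.comap_adj]; exact Or.inr ⟨by simp, rfl⟩)
  rintro ⟨⟨b, p⟩, hp⟩ ⟨⟨c, q⟩, hq⟩
  cases b <;> cases c
  · exact hside _ _ _ _ _
  · exact ((hside _ _ _ _ hr0).trans hmid).trans (hside _ _ _ _ _)
  · exact ((hside _ _ _ _ hr1).trans hmid.symm).trans (hside _ _ _ _ _)
  · exact hside _ _ _ _ _

lemma gridGraph_compl_adj {n : ℕ} {b c : Bool} {p q : Fin n × Fin n} :
    (gridGraph n)ᶜ.Adj (b, p) (c, q) ↔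
      (b = c ∧ p ≠ q ∧ gridPart b p = gridPart c q) ∨ (b ≠ c ∧ p ≠ q) := by
  rw [SimpleGraph.compl_adj, gridGraph_adj]
  by_cases h : b = c <;> simp [h]

/-- On each side a clique stays within one part, so another part survives intact. With `3 ≤ n` it
has a cell different from any two given ones, which links them from the opposite side. -/
lemma gridGraph_compl_isGraphAtom {n : ℕ} (hn : 3 ≤ n) : IsGraphAtom (gridGraph n)ᶜ := by
  rintro K ⟨hK, hdis⟩
  apply hdis
  have hpart : ∀ b p q, (b, p) ∈ K → (b, q) ∈ K → gridPart b p = gridPart b q := by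
    intro b p q h1 h2
    by_cases hne : p = q
    · rw [hne]
    have := hK h1 h2 (by simpa using hne)
    simp only [gridGraph_compl_adj] at this
    simpa [hne] using this
  have hthree : ∀ i j : Fin n, ∃ l, l ≠ i ∧ l ≠ j := by
    intro i j
    by_contra! h
    have : (Finset.univ : Finset (Fin n)) ⊆ {i, j} := fun l _ => by
      by_cases hl : l = i
      · simp [hl]
      · simp [h l hl]
    have := (Finset.card_le_card this).trans Finset.card_le_two
    simp at this
    omega
  have hfree : ∀ (b : Bool) (p q : Fin n × Fin n), ∃ r, r ≠ p ∧ r ≠ q ∧ (b, r) ∉ K := by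
    intro b p q
    obtain ⟨i, hi⟩ : ∃ i : Fin n, ∀ r, gridPart b r = i → (b, r) ∉ K := by
      by_cases h : ∃ r, (b, r) ∈ K
      · obtain ⟨r, hr⟩ := h
        obtain ⟨i, hi, -⟩ := hthree (gridPart b r) (gridPart b r)
        exact ⟨i, fun s hs hsK => hi (hs ▸ hpart b s r hsK hr)⟩
      · exact ⟨⟨0, by omega⟩, fun r _ hr => h ⟨r, hr⟩⟩
    obtain ⟨j, hj1, hj2⟩ := hthree (gridPart (!b) p) (gridPart (!b) q)
    obtain ⟨r, hr1, hr2⟩ := exists_gridPart b i j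
    exact ⟨r, fun h => hj1 (by rw [← hr2, h]), fun h => hj2 (by rw [← hr2, h]), hi r hr1⟩
  have hcross : ∀ (b c : Bool) (p q : Fin n × Fin n) (hp : (b, p) ∈ Kᶜ) (hq : (c, q) ∈ Kᶜ),
      b ≠ c → p ≠ q → ((gridGraph n)ᶜ.induce Kᶜ).Reachable ⟨_, hp⟩ ⟨_, hq⟩ :=
    fun b c p q hp hq hb h => SimpleGraph.Adj.reachable (by
      rw [SimpleGraph.comap_adj]; exact gridGraph_compl_adj.mpr (Or.inr ⟨hb, h⟩))
  have hside : ∀ (b : Bool) (p q : Fin n × Fin n) (hp : (b, p) ∈ Kᶜ) (hq : (b, q) ∈ Kᶜ),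
      ((gridGraph n)ᶜ.induce Kᶜ).Reachable ⟨_, hp⟩ ⟨_, hq⟩ := by
    intro b p q hp hq
    obtain ⟨r, h1, h2, h3⟩ := hfree (!b) p q
    exact (hcross _ _ _ _ hp h3 (by simp) h1.symm).trans (hcross _ _ _ _ h3 hq (by simp) h2)
  rintro ⟨⟨b, p⟩, hp⟩ ⟨⟨c, q⟩, hq⟩
  by_cases hb : b = c
  · subst hb
    exact hside _ _ _ _ _
  · obtain ⟨r, h1, -, h3⟩ := hfree b q q
    exact (hside b p r hp h3).trans (hcross _ _ _ _ h3 hq hb h1)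

/-! ### The lower bound on clique-width -/

/-- Vertices of `U` that are separated pairwise by vertices outside `U` need distinct labels. -/
lemma OuterLabelling.card_le {V ι : Type} {k : ℕ} {G : SimpleGraph V} {U : Set V} {ℓ : V → Fin k}
    (h : OuterLabelling G U ℓ) (A : Finset ι) (u w : ι → V) (hu : ∀ a ∈ A, u a ∈ U)
    (hw : ∀ a ∈ A, w a ∉ U)
    (hsep : ∀ a ∈ A, ∀ b ∈ A, a ≠ b → ¬ (G.Adj (u a) (w a) ↔ G.Adj (u b) (w a))) :
    A.card ≤ k := by
  have := Finset.card_le_card_of_injOn (s := A) (t := Finset.univ) (fun a => ℓ (u a))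
    (fun _ _ => Finset.mem_coe.mpr (Finset.mem_univ _)) (fun a ha b hb hab => by
      by_contra hne
      exact hsep a ha b hb hne (h _ (hu a ha) _ (hu b hb) hab _ (hw a ha)))
  simpa using this

/-- The outside vertex of a split part misses the chosen inside vertex of its own part and sees
those of all other parts. -/
lemma gridGraph_card_mixed_le {n k : ℕ} {U : Set (Bool × (Fin n × Fin n))}
    {ℓ : Bool × (Fin n × Fin n) → Fin k} (h : OuterLabelling (gridGraph n) U ℓ) (b : Bool)
    (A : Finset (Fin n))
    (hA : ∀ i ∈ A, ∃ p q, gridPart b p = i ∧ gridPart b q = i ∧ (b, p) ∈ U ∧ (b, q) ∉ U) :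
    A.card ≤ k := by
  choose! p q hp hq hpU hqU using hA
  refine h.card_le A (fun i => (b, p i)) (fun i => (b, q i)) hpU hqU ?_
  intro i hi j hj hij
  simp [gridGraph_adj, hp i hi, hq i hi, hp j hj, hij.symm]

/-- A vertex has only its partner as neighbour on the opposite side, so partners outside `U`
separate. -/
lemma gridGraph_card_matched_le {n k : ℕ} {U : Set (Bool × (Fin n × Fin n))}
    {ℓ : Bool × (Fin n × Fin n) → Fin k} (h : OuterLabelling (gridGraph n) U ℓ) (b : Bool)
    (A : Finset (Fin n)) (f : Fin n → Fin n × Fin n) (hf : Function.Injective f)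
    (hA : ∀ i ∈ A, (b, f i) ∈ U ∧ (!b, f i) ∉ U) : A.card ≤ k := by
  refine h.card_le A (fun i => (b, f i)) (fun i => (!b, f i)) (fun i hi => (hA i hi).1)
    (fun i hi => (hA i hi).2) ?_
  intro i hi j hj hij
  simp [gridGraph_adj, hf.eq_iff, hij.symm]

lemma ncard_le_of_rows {n k : ℕ} (S : Set (Fin n × Fin n)) (A : Finset (Fin n)) (hA : A.card ≤ k)
    (h : ∀ p ∈ S, p.1 ∈ A) : S.ncard ≤ k * n := by
  have h1 : S ⊆ ((A ×ˢ (Finset.univ : Finset (Fin n)) : Finset _) : Set (Fin n × Fin n)) :=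
    fun p hp => by simpa using h p hp
  have h2 := Set.ncard_le_ncard h1
  rw [Set.ncard_coe_finset, Finset.card_product, Finset.card_univ, Fintype.card_fin] at h2
  exact h2.trans (Nat.mul_le_mul_right n hA)

/-- A set of vertices of the grid graph with few distinct outer neighbourhoods contains almost all
or almost none of the first side. -/
lemma gridGraph_unbalanced {n k : ℕ} (hn : 3 * k < n) {U : Set (Bool × (Fin n × Fin n))}
    {ℓ : Bool × (Fin n × Fin n) → Fin k} (h : OuterLabelling (gridGraph n) U ℓ) :
    {p | (false, p) ∈ U}.ncard ≤ k * n ∨ {p | (false, p) ∉ U}.ncard ≤ k * n := by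
  classical
  have hA := gridGraph_card_mixed_le h false
    (Finset.univ.filter fun i => ∃ p q, gridPart false p = i ∧ gridPart false q = i ∧
      (false, p) ∈ U ∧ (false, q) ∉ U) (fun i hi => (Finset.mem_filter.mp hi).2)
  have hB := gridGraph_card_mixed_le h true
    (Finset.univ.filter fun i => ∃ p q, gridPart true p = i ∧ gridPart true q = i ∧
      (true, p) ∈ U ∧ (true, q) ∉ U) (fun i hi => (Finset.mem_filter.mp hi).2)
  by_contra! hcon
  obtain ⟨h1, h2⟩ := hcon
  -- If no row were full, all first-side vertices of `U` would lie in the at most `k` split rows.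
  have full : ∃ i, ∀ j, (false, (i, j)) ∈ U := by
    by_contra! hno
    refine absurd (ncard_le_of_rows _ _ hA ?_) (not_le.mpr h1)
    rintro ⟨i, j⟩ hp
    obtain ⟨j', hj'⟩ := hno i
    exact Finset.mem_filter.mpr ⟨Finset.mem_univ _, (i, j), (i, j'), rfl, rfl, hp, hj'⟩
  have empty : ∃ i, ∀ j, (false, (i, j)) ∉ U := by
    by_contra! hno
    refine absurd (ncard_le_of_rows _ _ hA ?_) (not_le.mpr h2)
    rintro ⟨i, j⟩ hp
    obtain ⟨j', hj'⟩ := hno i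
    exact Finset.mem_filter.mpr ⟨Finset.mem_univ _, (i, j'), (i, j), rfl, rfl, hj', hp⟩
  obtain ⟨i, hi⟩ := full
  obtain ⟨i', hi'⟩ := empty
  have hC := gridGraph_card_matched_le h false
    (Finset.univ.filter fun j => (true, (i, j)) ∉ U) (fun j => (i, j))
    (Prod.mk_right_injective i) (fun j hj => ⟨hi j, (Finset.mem_filter.mp hj).2⟩)
  have hD := gridGraph_card_matched_le h true
    (Finset.univ.filter fun j => (true, (i', j)) ∈ U) (fun j => (i', j))
    (Prod.mk_right_injective i') (fun j hj => ⟨(Finset.mem_filter.mp hj).2, hi' j⟩)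
  -- Column `j` of the second side meets the full row `i` and the empty row `i'`: either `U` splits
  -- it, or a matching edge at one of these two cells crosses the border of `U`.
  have hcover : (Finset.univ : Finset (Fin n)) ⊆
      ((Finset.univ.filter fun i => ∃ p q, gridPart true p = i ∧ gridPart true q = i ∧
        (true, p) ∈ U ∧ (true, q) ∉ U) ∪ (Finset.univ.filter fun j => (true, (i, j)) ∉ U)) ∪
      (Finset.univ.filter fun j => (true, (i', j)) ∈ U) := by
    intro j _
    simp only [Finset.mem_union, Finset.mem_filter, Finset.mem_univ, true_and]
    by_cases c1 : (true, (i, j)) ∈ U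
    · by_cases c2 : (true, (i', j)) ∈ U
      · exact Or.inr c2
      · exact Or.inl (Or.inl ⟨(i, j), (i', j), rfl, rfl, c1, c2⟩)
    · exact Or.inl (Or.inr c1)
  have hle := (Finset.card_le_card hcover).trans (Finset.card_union_le _ _)
  have hle2 := Finset.card_union_le
    (Finset.univ.filter fun i => ∃ p q, gridPart true p = i ∧ gridPart true q = i ∧
        (true, p) ∈ U ∧ (true, q) ∉ U) (Finset.univ.filter fun j => (true, (i, j)) ∉ U)
  rw [Finset.card_univ, Fintype.card_fin] at hle
  omega

lemma lt_cliqueWidth_of_outerLabelling {c n : ℕ} (hn : n = 3 * c + 4)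
    (G : SimpleGraph (Bool × (Fin n × Fin n)))
    (hG : ∀ (k : ℕ) (U : Set (Bool × (Fin n × Fin n))) (ℓ : Bool × (Fin n × Fin n) → Fin k),
      OuterLabelling G U ℓ → OuterLabelling (gridGraph n) U ℓ) :
    c < cliqueWidth G := by
  by_contra! hle
  have : Nonempty (Fin n) := ⟨⟨0, by omega⟩⟩
  have hfst : ∀ S : Set (Bool × (Fin n × Fin n)),
      (S ∩ {v | v.1 = false}).ncard = {p | (false, p) ∈ S}.ncard := by
    intro S
    rw [← Set.ncard_image_of_injective {p | (false, p) ∈ S} (Prod.mk_right_injective false)]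
    refine congrArg Set.ncard ?_
    ext ⟨b, p⟩
    cases b <;> simp
  have huniv : ({v | v.1 = false} : Set (Bool × (Fin n × Fin n))).ncard = n * n := by
    have := hfst Set.univ
    simpa [Set.ncard_univ] using this
  -- The first side has `n * n = 3 * (c * n) + 4 * n` vertices, so both `m` and the remainder after
  -- removing `2 * m` exceed `c * n`.
  obtain ⟨U, ℓ, h1, h2, h3⟩ := exists_balanced_outerLabelling G (m := c * n + 2) (by omega)
    {v | v.1 = false} (by rw [huniv]; subst hn; nlinarith)
  rw [hfst] at h1 h2
  have hk : cliqueWidth G * n ≤ c * n := Nat.mul_le_mul_right n hle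
  have hsum : {p | (false, p) ∈ U}.ncard + {p | (false, p) ∉ U}.ncard = n * n := by
    have := Set.ncard_add_ncard_compl {p | (false, p) ∈ U}
    simpa [Set.compl_ofPred] using this
  rcases gridGraph_unbalanced (by omega) (hG _ _ _ h3) with h | h
  · omega
  · have : n * n = 3 * (c * n) + 4 * n := by rw [← mul_assoc, ← add_mul, ← hn]
    omega

end CliqueWidth

theorem mainTheorem12 :
    ¬ CliqueWidth.BoundedCliqueWidth (CliqueWidth.freeAtoms CliqueWidth.gem CliqueWidth.P1twoP2) ∧
    ¬ CliqueWidth.BoundedCliqueWidth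
        (CliqueWidth.freeAtoms CliqueWidth.P1P4 CliqueWidth.P1twoP2ᶜ) := by
  constructor
  · rintro ⟨c, hc⟩
    refine absurd (hc _ (CliqueWidth.gridGraph (3 * c + 4))
      ⟨CliqueWidth.gridGraph_isGraphAtom (by omega), CliqueWidth.gridGraph_gem_free _,
        CliqueWidth.gridGraph_P1twoP2_free _⟩) (not_le.mpr ?_)
    exact CliqueWidth.lt_cliqueWidth_of_outerLabelling rfl _ fun _ _ _ h => h
  · rintro ⟨c, hc⟩
    refine absurd (hc _ (CliqueWidth.gridGraph (3 * c + 4))ᶜ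
      ⟨CliqueWidth.gridGraph_compl_isGraphAtom (by omega), fun h => ?_, fun h => ?_⟩)
      (not_le.mpr ?_)
    · refine CliqueWidth.gridGraph_gem_free (3 * c + 4) ?_
      rw [← SimpleGraph.compl_isIndContained_compl, compl_compl]
      exact h
    · exact CliqueWidth.gridGraph_P1twoP2_free (3 * c + 4) h.of_compl
    · exact CliqueWidth.lt_cliqueWidth_of_outerLabelling rfl _ fun _ _ _ h => h.of_compl
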